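/- A group has the finitely generated intersection property (FGIP) if the intersection of any two of its finitely generated subgroups is finitely generated. For a monomorphism $\phi\colon F\to F$ of a free group, the ascending HNN extension of $\phi$ is $\langle F,t \mid tft^{-1}=\phi(f)\ \forall f\in F\rangle$; it equals $F\rtimes_\phi\mathbb{Z}$ if $\phi$ is an automorphism. Let $V$ be a connected graph with a filtration by subgraphs $\emptyset=V^0\subsetneq V^1\subsetneq\cdots\subsetneq V^k=V$. A polynomial growth improved relative train track map $\Psi\colon V\to V$ (with respect to this filtration) is a map sending vertices to vertices and edges to combinatorial paths such that 1. $\Psi(V^r)\subseteq V^r$ for every $r$; 2. for every $r\ge 1$ the closure of $V^r-V^{r-1}$ is a single closed edge $e_r$ which, suitably oriented, satisfies $\Psi(e_r)=e_rP_r$, where $P_r$ is a (possibly trivial) closed path, all of whose edges lie in $V^{r-1}$ and whose initial point is fixed by $\Psi$. **Theorem.** Let $F$ be a non-cyclic free group of finite rank, let $\Psi\colon V\to V$ be a polynomial growth improved relative train track map of a connected graph $V$, let $p$ be a vertex of $V$, and identify $F$ with $\pi_1(V,p)$. Let $\phi\colon F\to F$ be a monomorphism induced by $\Psi$, i.e.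 $\phi([c])=[\gamma\,\Psi(c)\,\gamma^{-1}]$ for some path $\gamma$ in $V$ from $p$ to $\Psi(p)$. Then the ascending HNN extension of $\phi$ fails to have the FGIP. In particular, if $\phi$ is an automorphism, then $F\rtimes_\phi\mathbb{Z}$ fails to have the FGIP. -/

import Mathlib

universe u v w

/-- The finitely generated intersection property (Howson property). -/
def HasFGIP (G : Type*) [Group G] : Prop :=
  ∀ H K : Subgroup G, H.FG → K.FG → (H ⊓ K).FG

/-- The ascending HNN extension `⟨F, t ∣ t f t⁻¹ = φ f for all f ∈ F⟩` of a monomorphism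
`φ : F → F`. -/
abbrev AscendingHNN {F : Type*} [Group F] (φ : F →* F) (hφ : Function.Injective φ) : Type _ :=
  HNNExtension F ⊤ φ.range (Subgroup.topEquiv.trans (MonoidHom.ofInjective hφ))

namespace TrainTrack

open CategoryTheory Quiver

/-! A graph is a quiver `V`: the arrows are the geometric edges, each with an arbitrarily chosen
orientation. -/

/-- The type of all geometric edges of the graph. -/
abbrev Edge (V : Type u) [Quiver.{v} V] := Quiver.Total V

/-- Edges of the graph with either orientation, from `a` to `b`. -/
abbrev Dart {V : Type u} [Quiver.{v} V] (a b : V) := (a ⟶ b) ⊕ (b ⟶ a)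

/-- The geometric edge underlying an oriented edge. -/
def Dart.edge {V : Type u} [Quiver.{v} V] {a b : V} : Dart a b → Edge V
  | Sum.inl e => ⟨a, b, e⟩
  | Sum.inr e => ⟨b, a, e⟩

/-- Combinatorial paths: sequences of consecutive edges, crossed in either direction. -/
abbrev EdgePath {V : Type u} [Quiver.{v} V] (a b : V) :=
  @Quiver.Path (Symmetrify V) _ a b

/-- The path of length one along an oriented edge. -/
def Dart.toEdgePath {V : Type u} [Quiver.{v} V] {a b : V} (d : Dart a b) : EdgePath a b :=
  @Quiver.Hom.toPath (Symmetrify V) _ a b d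

/-- The graph is connected (it is nonempty as soon as a base point is given). -/
def IsConnectedGraph (V : Type u) [Quiver.{v} V] : Prop :=
  ∀ a b : V, Nonempty (EdgePath a b)

/-- A subgraph: a set of vertices and a set of edges containing the endpoints of its edges. -/
structure Subgraph (V : Type u) [Quiver.{v} V] where
  verts : Set V
  edges : Set (Edge V)
  left_mem : ∀ e ∈ edges, e.left ∈ verts
  right_mem : ∀ e ∈ edges, e.right ∈ verts

/-- All edges crossed by the path belong to `H`. -/
def EdgePath.InSubgraph {V : Type u} [Quiver.{v} V] (H : Subgraph V) {a : V} :
    ∀ {b : V}, EdgePath a b → Prop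
  | _, .nil => True
  | _, .cons p d => EdgePath.InSubgraph H p ∧ Dart.edge d ∈ H.edges

/-- A self-map of the graph sending vertices to vertices and edges to combinatorial paths. -/
structure GraphMap (V : Type u) [Quiver.{v} V] where
  obj : V → V
  map : ∀ {a b : V}, (a ⟶ b) → EdgePath (obj a) (obj b)

/-- The image of an oriented edge. -/
def GraphMap.mapDart {V : Type u} [Quiver.{v} V] (Ψ : GraphMap V) {a b : V} :
    Dart a b → EdgePath (Ψ.obj a) (Ψ.obj b)
  | Sum.inl e => Ψ.map e
  | Sum.inr e => (Ψ.map e).reverse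

/-- `Ψ` maps the subgraph `H` into itself. -/
def GraphMap.Preserves {V : Type u} [Quiver.{v} V] (Ψ : GraphMap V) (H : Subgraph V) : Prop :=
  (∀ a ∈ H.verts, Ψ.obj a ∈ H.verts) ∧
    ∀ e ∈ H.edges, EdgePath.InSubgraph H (Ψ.map e.hom)

/-- `Ψ` is a polynomial growth improved relative train track map with respect to the filtration
`∅ = Fil 0 ⊊ Fil 1 ⊊ ⋯ ⊊ Fil k = V`. The condition `single_edge` says that the closure of
`Fil (r+1) - Fil r` is one closed edge `d` (suitably oriented, from `a` to `b`), and that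
`Ψ(d) = d P` for a closed path `P` in `Fil r` based at a point fixed by `Ψ`. The path `P` may be
trivial (this is the only possibility in the bottom stratum); then `Ψ(d) = d`. -/
structure IsPolynomialIRTT {V : Type u} [Quiver.{v} V] (Ψ : GraphMap V) (k : ℕ)
    (Fil : Fin (k + 1) → Subgraph V) : Prop where
  bot_verts : (Fil 0).verts = ∅
  bot_edges : (Fil 0).edges = ∅
  top_verts : (Fil (Fin.last k)).verts = Set.univ
  top_edges : (Fil (Fin.last k)).edges = Set.univ
  mono_verts : ∀ r : Fin k, (Fil r.castSucc).verts ⊆ (Fil r.succ).verts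
  mono_edges : ∀ r : Fin k, (Fil r.castSucc).edges ⊆ (Fil r.succ).edges
  invariant : ∀ r, Ψ.Preserves (Fil r)
  single_edge : ∀ r : Fin k, ∃ (a b : V) (d : Dart a b),
    (Fil r.succ).edges \ (Fil r.castSucc).edges = {Dart.edge d} ∧
    (Fil r.succ).verts \ (Fil r.castSucc).verts ⊆ {a, b} ∧
    ∃ (ha : Ψ.obj a = a) (hb : Ψ.obj b = b) (P : EdgePath b b),
      EdgePath.InSubgraph (Fil r.castSucc) P ∧
      Ψ.mapDart d =
        @Quiver.Path.cast (Symmetrify V) _ _ _ _ _ ha.symm hb.symm (d.toEdgePath.comp P)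

/-- The homotopy class, relative to endpoints, of a combinatorial path, as a morphism of the
fundamental groupoid of the graph. -/
def EdgePath.homotopyClass {V : Type u} [Quiver.{v} V] {a b : V} (p : EdgePath a b) :
    (FreeGroupoid.of V).obj a ⟶ (FreeGroupoid.of V).obj b :=
  (Quotient.functor (@FreeGroupoid.redStep V _)).map p

/-- The functor induced by `Ψ` on the fundamental groupoid of the graph. -/
def GraphMap.functor {V : Type u} [Quiver.{v} V] (Ψ : GraphMap V) :
    Quiver.FreeGroupoid V ⥤ Quiver.FreeGroupoid V :=
  FreeGroupoid.lift
    { obj := fun a => (FreeGroupoid.of V).obj (Ψ.obj a)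
      map := fun e => EdgePath.homotopyClass (Ψ.map e) }

/-- The fundamental group of the graph `V` at `p`: homotopy classes of closed combinatorial paths
at `p`, multiplied by concatenation. -/
abbrev FundGroup (V : Type u) [Quiver.{v} V] (p : V) :=
  (FreeGroupoid.of V).obj p ⟶ (FreeGroupoid.of V).obj p

/-- Under the identification `ι` of `F` with `π₁(V, p)`, the endomorphism `φ` is induced by `Ψ`:
there is a path `γ` from `p` to `Ψ(p)` such that `φ` is `[c] ↦ [γ Ψ(c) γ⁻¹]`. -/
def IsInducedBy {V : Type u} [Quiver.{v} V] {F : Type w} [Group F] (φ : F →* F)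
    (Ψ : GraphMap V) (p : V) (ι : F ≃* FundGroup V p) : Prop :=
  ∃ γ : EdgePath p (Ψ.obj p), ∀ x : F,
    ι (φ x) = γ.homotopyClass ≫ Ψ.functor.map (ι x) ≫ Groupoid.inv γ.homotopyClass

end TrainTrack

/-!
Suppose that noncommuting elements `a`, `b` of a free group `F` satisfy `c φ(a) c⁻¹ = a` and
`c φ(b) c⁻¹ = b a ^ m` for some `c`. In the HNN extension the element `s = c t` then commutes with
`a`, and `s b s⁻¹ = b a ^ m`, so `a` has the same normal closure `N` in `⟨a, b⟩` as in `⟨a, b s⟩`.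
Both quotients by `N` are cyclic, and counting `t` shows that `⟨a, b s⟩ ∩ ⟨a, b⟩ = N`. As `a`, `b`
is a free basis of `⟨a, b⟩`, the group `N` is not finitely generated: let `a` act on `ℤ` by a
transposition and `b` by a translation.

If there is no such pair at any vertex, then `Ψ` acts trivially on all the vertex groups of the
fundamental groupoid of `Vʳ`, by induction on `r`; at the top this makes `F` commutative, hence
cyclic. Let `d` be the new edge, `Ψ(d) = d P`. A loop `d m` with `m` in the old subgraph satisfies
`Ψ(d m) = d m e`, where `e` is an old loop, fixed by induction. If `e ≠ 1`, then `e` and `d m` do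
not commute, because commuting elements of a free group have a common nontrivial power, while the
signed number of crossings of `d` is zero on `e` but not on `d m`; so they form such a pair. If `P`
fails to commute with an old loop `m`, then `P` and `m` are two noncommuting fixed elements, again
such a pair; and if it commutes, then `Ψ(d m d⁻¹) = d m d⁻¹`.
-/

section FreeGroups

theorem exists_perm_apply_eq {α : Type*} (τ : Equiv.Perm α) (S : Finset α) :
    ∃ σ : Equiv.Perm S, ∀ s : S, τ s ∈ S → (σ s : α) = τ s :=
  Set.MapsTo.exists_equiv_extend_of_card_eq (Fintype.card_coe S)
    (s := {s : S | τ s ∈ S}) (f := fun s => τ s) (fun _ hs => hs)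
    (τ.injective.comp Subtype.val_injective).injOn

theorem lift_mk_apply_one {α : Type*} {S : Finset (FreeGroup α)} {σ : α → Equiv.Perm S}
    (hσ : ∀ x (s : S), FreeGroup.of x * s.1 ∈ S → (σ x s).1 = FreeGroup.of x * s.1)
    (h_one : 1 ∈ S) {L : List (α × Bool)} (hL : ∀ L', L' <:+ L → FreeGroup.mk L' ∈ S) :
    (FreeGroup.lift σ (FreeGroup.mk L) ⟨1, h_one⟩ : FreeGroup α) = FreeGroup.mk L := by
  induction L with
  | nil => rfl
  | cons e L ih =>
    have ih := ih fun L' h => hL L' (h.trans (List.suffix_cons e L))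
    set s := FreeGroup.lift σ (FreeGroup.mk L) ⟨1, h_one⟩
    have hs : FreeGroup.mk (e :: L) ∈ S := hL _ List.suffix_rfl
    obtain ⟨x, _ | _⟩ := e
    · have hx : FreeGroup.mk ((x, false) :: L) = (FreeGroup.of x)⁻¹ * FreeGroup.mk L := rfl
      rw [hx] at hs ⊢
      rw [map_mul, map_inv, FreeGroup.lift_apply_of, Equiv.Perm.mul_apply,
        (Equiv.Perm.inv_eq_iff_eq (y := ⟨_, hs⟩)).2]
      refine Subtype.ext ?_
      rw [hσ x ⟨_, hs⟩ (by rw [mul_inv_cancel_left, ← ih]; exact s.2), mul_inv_cancel_left]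
      exact ih
    · have hx : FreeGroup.mk ((x, true) :: L) = FreeGroup.of x * FreeGroup.mk L := rfl
      rw [hx] at hs ⊢
      rw [map_mul, FreeGroup.lift_apply_of, Equiv.Perm.mul_apply, hσ x s (by rwa [ih]), ih]

instance freeGroup_residuallyFinite (α : Type*) : Group.ResiduallyFinite (FreeGroup α) := by
  classical
  -- Left multiplication by a generator is a partial permutation of the suffixes of a word.
  refine Group.residuallyFinite_of_forall_exists_finite_monoidHom fun g hg => ?_
  let S : Finset (FreeGroup α) := (g.toWord.tails.map FreeGroup.mk).toFinset
  have hS (L : List (α × Bool)) (hL : L <:+ g.toWord) : FreeGroup.mk L ∈ S :=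
    List.mem_toFinset.2 (List.mem_map_of_mem ((List.mem_tails _ _).2 hL))
  have h_one : 1 ∈ S := hS [] List.nil_suffix
  choose σ hσ using fun x => exists_perm_apply_eq (Equiv.mulLeft (FreeGroup.of x)) S
  refine ⟨Equiv.Perm S, inferInstance, inferInstance, FreeGroup.lift σ, fun h => hg ?_⟩
  have h_apply := lift_mk_apply_one hσ h_one hS
  rw [FreeGroup.mk_toWord, h] at h_apply
  exact h_apply.symm

theorem finite_monoidHom (G H : Type*) [Group G] [Group.FG G] [Group H] [Finite H] :
    Finite (G →* H) := by
  obtain ⟨S, hS⟩ := Group.FG.out (G := G)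
  exact Finite.of_injective (fun (f : G →* H) (s : S) => f s) fun f g hfg =>
    MonoidHom.eq_of_eqOn_dense hS fun s hs => congrFun hfg ⟨s, hs⟩

theorem injective_of_surjective_of_residuallyFinite {G : Type*} [Group G] [Group.FG G]
    [Group.ResiduallyFinite G] {f : G →* G} (hf : Function.Surjective f) :
    Function.Injective f := by
  rw [injective_iff_map_eq_one]
  intro g hg
  by_contra hne
  obtain ⟨N, hN⟩ := Group.exists_finiteIndexNormalSubgroup_notMem g hne
  have := finite_monoidHom G (G ⧸ N.toSubgroup)
  have hcomp : Function.Surjective fun q : G →* G ⧸ N.toSubgroup => q.comp f :=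
    Finite.injective_iff_surjective.1 fun _ _ => (MonoidHom.cancel_right hf).1
  obtain ⟨q, hq⟩ := hcomp (QuotientGroup.mk' N.toSubgroup)
  refine hN ((QuotientGroup.eq_one_iff g).1 ?_)
  calc (g : G ⧸ N.toSubgroup) = q (f g) := (DFunLike.congr_fun hq g).symm
    _ = 1 := by rw [hg, map_one]

variable {G : Type*} [Group G] [IsFreeGroup G]

theorem isCyclic_of_subsingleton_generators [Subsingleton (IsFreeGroup.Generators G)] :
    IsCyclic G := by
  have : IsCyclic (FreeGroup (IsFreeGroup.Generators G)) := by
    cases isEmpty_or_nonempty (IsFreeGroup.Generators G) with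
    | inl _ => infer_instance
    | inr _ =>
      have := uniqueOfSubsingleton (Classical.arbitrary (IsFreeGroup.Generators G))
      infer_instance
  exact isCyclic_of_surjective (IsFreeGroup.mulEquiv G) (IsFreeGroup.mulEquiv G).surjective

theorem exists_surjective_freeGroup_bool (hG : ¬ IsCyclic G) :
    ∃ q : G →* FreeGroup Bool, Function.Surjective q := by
  classical
  have : Nontrivial (IsFreeGroup.Generators G) := by
    by_contra h
    rw [not_nontrivial_iff_subsingleton] at h
    exact hG isCyclic_of_subsingleton_generators
  obtain ⟨x, y, hxy⟩ := exists_pair_ne (IsFreeGroup.Generators G)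
  refine ⟨IsFreeGroup.lift fun z => FreeGroup.of (z = x), ?_⟩
  rw [← MonoidHom.range_eq_top, eq_top_iff, ← FreeGroup.closure_range_of, Subgroup.closure_le]
  rintro _ ⟨_ | _, rfl⟩
  · exact ⟨IsFreeGroup.of y, by simp [hxy.symm]⟩
  · exact ⟨IsFreeGroup.of x, by simp⟩

theorem isCyclic_of_forall_commute (h : ∀ x y : G, Commute x y) : IsCyclic G := by
  by_contra hG
  obtain ⟨q, hq⟩ := exists_surjective_freeGroup_bool hG
  obtain ⟨x, hx⟩ := hq (FreeGroup.of true)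
  obtain ⟨y, hy⟩ := hq (FreeGroup.of false)
  have hxy := (h x y).map q
  rw [hx, hy] at hxy
  exact absurd hxy.eq (by decide)

open Subgroup in
theorem exists_zpow_eq_zpow_of_commute {x y : G} (h : Commute x y) (hy : y ≠ 1) :
    ∃ i j : ℤ, j ≠ 0 ∧ x ^ j = y ^ i := by
  have hcomm : ∀ u ∈ ({x, y} : Set G), ∀ v ∈ ({x, y} : Set G), u * v = v * u := by
    rintro u (rfl | rfl) v (rfl | rfl)
    exacts [rfl, h, h.symm, rfl]
  have := isMulCommutative_closure hcomm
  have hcyc : IsCyclic (closure {x, y}) :=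
    isCyclic_of_forall_commute fun u v => mul_comm' u v
  obtain ⟨z, hz⟩ := hcyc.exists_generator
  obtain ⟨i, hi⟩ := hz ⟨x, subset_closure (by simp)⟩
  obtain ⟨j, hj⟩ := hz ⟨y, subset_closure (by simp)⟩
  have hzx : (z : G) ^ i = x := congrArg Subtype.val hi
  have hzy : (z : G) ^ j = y := congrArg Subtype.val hj
  refine ⟨i, j, fun h0 => hy (by rw [← hzy, h0, zpow_zero]), ?_⟩
  calc x ^ j = ((z : G) ^ i) ^ j := by rw [hzx]
    _ = ((z : G) ^ j) ^ i := zpow_comm _ _ _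
    _ = y ^ i := by rw [hzy]

theorem injective_lift_of_not_commute {a b : G} (h : ¬ Commute a b) :
    Function.Injective (FreeGroup.lift fun i : Bool => if i then a else b) := by
  set f := FreeGroup.lift fun i : Bool => if i then a else b with hf
  have hrange : ¬ IsCyclic f.range := fun _ => h <| by
    have hmul := mul_comm' (⟨a, FreeGroup.of true, by simp [hf]⟩ : f.range)
      ⟨b, FreeGroup.of false, by simp [hf]⟩
    exact congrArg Subtype.val hmul
  obtain ⟨q, hq⟩ := exists_surjective_freeGroup_bool hrange
  have hinj := injective_of_surjective_of_residuallyFinite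
    (f := q.comp f.rangeRestrict) (hq.comp f.rangeRestrict_surjective)
  exact MonoidHom.rangeRestrict_injective_iff.1 (Function.Injective.of_comp hinj)

end FreeGroups

section ConjClosure

open Subgroup
open scoped Pointwise

variable {G H : Type*} [Group G] [Group H] {a b s : G} {m : ℤ}

/-- The normal closure of `a` in the subgroup generated by `a` and `b`. The conjugates of `a` by the
powers of `b` generate it, since their closure is normalized by `a` and `b`. -/
def conjClosure (a b : G) : Subgroup G :=
  closure (Set.range fun n : ℤ => b ^ n * a * (b ^ n)⁻¹)

theorem conj_zpow_mem_conjClosure (a b : G) (n : ℤ) : b ^ n * a * (b ^ n)⁻¹ ∈ conjClosure a b :=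
  subset_closure ⟨n, rfl⟩

theorem left_mem_conjClosure (a b : G) : a ∈ conjClosure a b := by
  simpa using conj_zpow_mem_conjClosure a b 0

theorem right_mem_normalizer_conjClosure (a b : G) :
    b ∈ normalizer (conjClosure a b : Set G) := by
  refine normalizer_le_normalizer_closure _ (mem_normalizer_iff_conj_image_eq.2 ?_)
  rw [← Set.range_comp, ← (Equiv.addLeft (1 : ℤ)).surjective.range_comp fun n => b ^ n * a * _]
  refine congrArg Set.range (funext fun n => ?_)
  simp only [Function.comp_apply, MulAut.conj_apply, Equiv.coe_addLeft, zpow_one_add]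
  group

theorem conjClosure_le {N : Subgroup G} (ha : a ∈ N) (hb : b ∈ normalizer (N : Set G)) :
    conjClosure a b ≤ N := by
  rw [conjClosure, closure_le]
  rintro _ ⟨n, rfl⟩
  exact (mem_normalizer_iff.1 (zpow_mem hb n) a).1 ha

theorem conjClosure_le_closure_pair (a b : G) : conjClosure a b ≤ closure {a, b} :=
  conjClosure_le (subset_closure (by simp)) (le_normalizer (subset_closure (by simp)))

theorem map_conjClosure (f : G →* H) (a b : G) :
    (conjClosure a b).map f = conjClosure (f a) (f b) := by
  rw [conjClosure, conjClosure, MonoidHom.map_closure, ← Set.range_comp]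
  simp [Function.comp_def]

theorem zpow_mem_normalizer_conjClosure (a b : G) (m : ℤ) :
    a ^ m ∈ normalizer (conjClosure a b : Set G) :=
  le_normalizer (zpow_mem (left_mem_conjClosure a b) m)

theorem conjClosure_mul_zpow (a b : G) (m : ℤ) : conjClosure a (b * a ^ m) = conjClosure a b := by
  apply le_antisymm <;> refine conjClosure_le (left_mem_conjClosure _ _) ?_
  · exact mul_mem (right_mem_normalizer_conjClosure a b) (zpow_mem_normalizer_conjClosure a b m)
  · simpa using mul_mem (right_mem_normalizer_conjClosure a (b * a ^ m))
      (inv_mem (zpow_mem_normalizer_conjClosure a (b * a ^ m) m))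

theorem mem_normalizer_conjClosure (hsa : s * a * s⁻¹ = a) (hsb : s * b * s⁻¹ = b * a ^ m) :
    s ∈ normalizer (conjClosure a b : Set G) := by
  rw [mem_normalizer_iff_map_conj_eq, map_conjClosure]
  simp [hsa, hsb, conjClosure_mul_zpow]

theorem conjClosure_mul_right (hsa : s * a * s⁻¹ = a) (hsb : s * b * s⁻¹ = b * a ^ m) :
    conjClosure a (b * s) = conjClosure a b := by
  have hsbs : s * (b * s) * s⁻¹ = b * s * a ^ m := by
    have hs_comm : Commute s (a ^ m) := Commute.zpow_right (mul_inv_eq_iff_eq_mul.1 hsa) m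
    rw [← mul_assoc, mul_inv_eq_iff_eq_mul.1 hsb, mul_inv_cancel_right, mul_assoc, mul_assoc,
      hs_comm.eq]
  apply le_antisymm <;> refine conjClosure_le (left_mem_conjClosure _ _) ?_
  · exact mul_mem (right_mem_normalizer_conjClosure a b) (mem_normalizer_conjClosure hsa hsb)
  · simpa using mul_mem (right_mem_normalizer_conjClosure a (b * s))
      (inv_mem (mem_normalizer_conjClosure hsa hsbs))

theorem exists_mul_zpow_eq_of_mem_closure_pair {g : G} (hg : g ∈ closure {a, b}) :
    ∃ x ∈ conjClosure a b, ∃ n : ℤ, x * b ^ n = g := by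
  have hle : closure {a, b} ≤ conjClosure a b ⊔ zpowers b := by
    rw [closure_le, Set.pair_subset_iff]
    exact ⟨mem_sup_left (left_mem_conjClosure a b), mem_sup_right (mem_zpowers b)⟩
  have hmul := coe_mul_of_right_le_normalizer_left (conjClosure a b) (zpowers b)
    (by simpa using right_mem_normalizer_conjClosure a b)
  have hg' : g ∈ (conjClosure a b : Set G) * (zpowers b : Set G) := hmul.subset (hle hg)
  obtain ⟨x, hx, _, ⟨n, rfl⟩, hxn⟩ := hg'
  exact ⟨x, hx, n, hxn⟩

theorem closure_pair_inf_eq_conjClosure (π : G →* H) (ha : π a = 1) (hb : π b = 1)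
    (hs : ¬ IsOfFinOrder (π s)) (hsa : s * a * s⁻¹ = a) (hsb : s * b * s⁻¹ = b * a ^ m) :
    closure {a, b * s} ⊓ closure {a, b} = conjClosure a b := by
  apply le_antisymm
  · rintro g ⟨hg, hg'⟩
    obtain ⟨x, hx, n, rfl⟩ := exists_mul_zpow_eq_of_mem_closure_pair hg
    rw [conjClosure_mul_right hsa hsb] at hx
    have hker : closure {a, b} ≤ π.ker := by
      rw [closure_le, Set.pair_subset_iff]
      exact ⟨ha, hb⟩
    have hπx : π x = 1 := hker (conjClosure_le_closure_pair a b hx)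
    have hπn : π s ^ n = 1 := by simpa [hπx, hb] using MonoidHom.mem_ker.1 (hker hg')
    have hn : n = 0 := injective_zpow_iff_not_isOfFinOrder.2 hs (by simpa using hπn)
    simpa [hn] using hx
  · refine le_inf ?_ (conjClosure_le_closure_pair a b)
    rw [← conjClosure_mul_right hsa hsb]
    exact conjClosure_le_closure_pair a (b * s)

theorem not_hasFGIP_of_not_fg_conjClosure (hab : ¬ (conjClosure a b).FG) (π : G →* H)
    (ha : π a = 1) (hb : π b = 1) (hs : ¬ IsOfFinOrder (π s)) (hsa : s * a * s⁻¹ = a)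
    (hsb : s * b * s⁻¹ = b * a ^ m) : ¬ HasFGIP G := by
  have hpair (x y : G) : (closure {x, y}).FG := (fg_iff _).2 ⟨_, rfl, Set.toFinite _⟩
  intro hG
  have hfg := hG _ _ (hpair a (b * s)) (hpair a b)
  rw [closure_pair_inf_eq_conjClosure π ha hb hs hsa hsb] at hfg
  exact hab hfg

theorem swap_mem_conjClosure (n : ℤ) :
    Equiv.swap n (n + 1) ∈ conjClosure (Equiv.swap (0 : ℤ) 1) (Equiv.addRight 1) := by
  have h := conj_zpow_mem_conjClosure (Equiv.swap (0 : ℤ) 1) (Equiv.addRight 1) n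
  rw [← Equiv.swap_apply_apply] at h
  simpa [add_comm] using h

theorem eventually_apply_eq_of_mem_conjClosure {σ : Equiv.Perm ℤ}
    (hσ : σ ∈ conjClosure (Equiv.swap (0 : ℤ) 1) (Equiv.addRight 1)) :
    ∀ᶠ k in Filter.atTop, σ k = k := by
  rw [conjClosure] at hσ
  induction hσ using closure_induction with
  | mem _ h =>
    obtain ⟨n, rfl⟩ := h
    filter_upwards [Filter.eventually_gt_atTop (n + 1)] with k hk
    simp only [← Equiv.swap_apply_apply]
    apply Equiv.swap_apply_of_ne_of_ne <;> simp <;> omega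
  | one => simp
  | mul σ τ _ _ hσ hτ =>
    filter_upwards [hσ, hτ] with k hσk hτk
    rw [Equiv.Perm.mul_apply, hτk, hσk]
  | inv σ _ hσ =>
    filter_upwards [hσ] with k hσk
    exact Equiv.Perm.inv_eq_iff_eq.2 hσk.symm

theorem not_fg_conjClosure_swap_addRight :
    ¬ (conjClosure (Equiv.swap (0 : ℤ) 1) (Equiv.addRight 1)).FG := by
  rintro ⟨T, hT⟩
  have hfix : ∀ᶠ k in Filter.atTop, ∀ σ ∈ T, σ k = k :=
    (Filter.eventually_all_finset T).2 fun σ hσ =>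
      eventually_apply_eq_of_mem_conjClosure (hT ▸ subset_closure hσ)
  obtain ⟨k, hk⟩ := hfix.exists
  have hle : closure (T : Set (Equiv.Perm ℤ)) ≤ MulAction.stabilizer (Equiv.Perm ℤ) k :=
    (closure_le _).2 hk
  have hswap : Equiv.swap k (k + 1) k = k := hle (hT ▸ swap_mem_conjClosure k)
  simp at hswap

theorem fg_map {K : Subgroup G} (hK : K.FG) (f : G →* H) : (K.map f).FG := by
  rw [fg_iff_submonoid_fg] at hK ⊢
  exact hK.map f

theorem fg_of_fg_map {K : Subgroup G} {f : G →* H} (hf : Function.Injective f)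
    (hK : (K.map f).FG) : K.FG := by
  rw [fg_iff_submonoid_fg] at hK ⊢
  exact Submonoid.FG.map_injective f hf hK

theorem not_fg_conjClosure_of_not_commute [IsFreeGroup G] (hab : ¬ Commute a b) :
    ¬ (conjClosure a b).FG := by
  intro hfg
  have hfree : (conjClosure (FreeGroup.of true) (FreeGroup.of false)).FG := by
    refine fg_of_fg_map (injective_lift_of_not_commute hab) ?_
    simpa [map_conjClosure] using hfg
  refine not_fg_conjClosure_swap_addRight ?_
  simpa [map_conjClosure] using fg_map hfree
    (FreeGroup.lift fun i => if i then Equiv.swap (0 : ℤ) 1 else Equiv.addRight 1)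

end ConjClosure

section UnipotentPair

/-- An endomorphism has a unipotent pair if it acts on two noncommuting elements `a`, `b` by
`a ↦ a` and `b ↦ b * a ^ m`, i.e. by a unipotent matrix on the abelianization. -/
def HasUnipotentPair {G : Type*} [Group G] (φ : G →* G) : Prop :=
  ∃ (a b : G) (m : ℤ), ¬ Commute a b ∧ φ a = a ∧ φ b = b * a ^ m

theorem HasUnipotentPair.of_semiconj {G H : Type*} [Group G] [Group H] {φ : G →* G}
    {ψ : H →* H} (hφ : HasUnipotentPair φ) (e : G ≃* H) (h : ∀ z, ψ (e z) = e (φ z)) :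
    HasUnipotentPair ψ := by
  obtain ⟨a, b, m, hab, ha, hb⟩ := hφ
  refine ⟨e a, e b, m, fun he => hab (by simpa using he.map e.symm), ?_, ?_⟩
  · rw [h, ha]
  · rw [h, hb, map_mul, map_zpow]

theorem commute_of_not_hasUnipotentPair {G : Type*} [Group G] {φ : G →* G}
    (hφ : ¬ HasUnipotentPair φ) {a b : G} (ha : φ a = a) (hb : φ b = b) : Commute a b := by
  by_contra hab
  exact hφ ⟨a, b, 0, hab, ha, by rw [hb, zpow_zero, mul_one]⟩

variable {F : Type*} [Group F] [IsFreeGroup F] {φ : F →* F} {c : F}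

theorem not_hasFGIP_of_hasUnipotentPair {G A : Type*} [Group G] [Group A]
    (hc : HasUnipotentPair ((MulAut.conj c).toMonoidHom.comp φ)) {j : F →* G}
    (hj : Function.Injective j) {t : G} (ht : ∀ z, t * j z * t⁻¹ = j (φ z)) (π : G →* A)
    (hπj : ∀ z, π (j z) = 1) (hπt : ¬ IsOfFinOrder (π t)) : ¬ HasFGIP G := by
  obtain ⟨a, b, m, hab, ha, hb⟩ := hc
  have hconj (z : F) : j c * t * j z * (j c * t)⁻¹ = j (c * φ z * c⁻¹) := by
    rw [map_mul, map_mul, map_inv, ← ht]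
    group
  have hnfg : ¬ (conjClosure (j a) (j b)).FG := fun hfg =>
    not_fg_conjClosure_of_not_commute hab (fg_of_fg_map hj (by rwa [map_conjClosure]))
  refine not_hasFGIP_of_not_fg_conjClosure (s := j c * t) (m := m) hnfg π (hπj a) (hπj b)
    (by rwa [map_mul, hπj, one_mul]) ?_ ?_
  · exact (hconj a).trans (congrArg j ha)
  · rw [hconj, ← map_zpow, ← map_mul]
    exact congrArg j hb

theorem not_hasFGIP_ascendingHNN (hc : HasUnipotentPair ((MulAut.conj c).toMonoidHom.comp φ))
    (hφ : Function.Injective φ) : ¬ HasFGIP (AscendingHNN φ hφ) :=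
  not_hasFGIP_of_hasUnipotentPair hc (HNNExtension.of_injective _)
    (fun z => (HNNExtension.equiv_eq_conj (⟨z, trivial⟩ : (⊤ : Subgroup F))).symm)
    (HNNExtension.lift 1 (Multiplicative.ofAdd (1 : ℤ)) (by simp)) (by simp)
    (by simp [isOfFinOrder_iff_eq_one])

theorem not_hasFGIP_semidirectProduct {θ : MulAut F}
    (hc : HasUnipotentPair ((MulAut.conj c).toMonoidHom.comp θ.toMonoidHom)) :
    ¬ HasFGIP (F ⋊[zpowersHom (MulAut F) θ] Multiplicative ℤ) :=
  not_hasFGIP_of_hasUnipotentPair hc SemidirectProduct.inl_injective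
    (t := SemidirectProduct.inr (Multiplicative.ofAdd 1))
    (fun z => by simpa using
      (SemidirectProduct.inl_aut (φ := zpowersHom (MulAut F) θ) (Multiplicative.ofAdd 1) z).symm)
    SemidirectProduct.rightHom (by simp) (by simp [isOfFinOrder_iff_eq_one])

end UnipotentPair

namespace TrainTrack

open CategoryTheory Quiver

section Adjoin

variable {C : Type u} [Groupoid.{v} C]

/-- The subgroupoid generated by `M` and the morphism `d`. -/
def adjoin (M : Subgroupoid C) {a b : C} (d : a ⟶ b) : Subgroupoid C :=
  sInf {K | M ≤ K ∧ d ∈ K.arrows a b}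

variable {M K : Subgroupoid C} {a b x y z : C} {d : a ⟶ b}

theorem subset_adjoin : M.arrows x y ⊆ (adjoin M d).arrows x y := fun _ hf =>
  Subgroupoid.mem_sInf_arrows.2 fun _ hK => (Subgroupoid.le_iff _ _).1 hK.1 hf

theorem mem_adjoin : d ∈ (adjoin M d).arrows a b :=
  Subgroupoid.mem_sInf_arrows.2 fun _ hK => hK.2

theorem adjoin_subset (hM : M ≤ K) (hd : d ∈ K.arrows a b) :
    (adjoin M d).arrows x y ⊆ K.arrows x y := fun _ hf =>
  Subgroupoid.mem_sInf_arrows.1 hf K ⟨hM, hd⟩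

theorem adjoin_induction_right {T : ∀ y : C, (x ⟶ y) → Prop}
    (comp_mem : ∀ {y z : C} (f : x ⟶ y), T y f → ∀ g ∈ M.arrows y z, T z (f ≫ g))
    (comp_hom : ∀ f : x ⟶ a, T a f → T b (f ≫ d))
    (comp_inv : ∀ f : x ⟶ b, T b f → T a (f ≫ Groupoid.inv d))
    {f : x ⟶ y} (hf : T y f) {g : y ⟶ z} (hg : g ∈ (adjoin M d).arrows y z) : T z (f ≫ g) := by
  let stabilizer : Subgroupoid C :=
    { arrows := fun y z => {g | (∀ f, T y f → T z (f ≫ g)) ∧ ∀ f, T z f → T y (f ≫ Groupoid.inv g)}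
      inv := fun {_ _ g} hg => ⟨hg.2, by simpa using hg.1⟩
      mul := fun {_ _ _ g} hg {h} hh =>
        ⟨fun f hf => by simpa using hh.1 _ (hg.1 f hf),
          fun f hf => by simpa using hg.2 _ (hh.2 f hf)⟩ }
  have hM : M ≤ stabilizer := (Subgroupoid.le_iff _ _).2 fun hm =>
    ⟨fun f hf => comp_mem f hf _ hm, fun f hf => comp_mem f hf _ (M.inv hm)⟩
  exact (adjoin_subset hM ⟨comp_hom, comp_inv⟩ hg).1 f hf

theorem mem_of_mem_adjoin (hM : M.IsWide) (hx : ∀ g : a ⟶ x, g ∉ (adjoin M d).arrows a x)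
    {f : x ⟶ y} (hf : f ∈ (adjoin M d).arrows x y) : f ∈ M.arrows x y := by
  rw [← Category.id_comp f]
  refine adjoin_induction_right (T := fun y f => f ∈ M.arrows x y) (fun f hf g hg => M.mul hf hg)
    ?_ ?_ (hM.wide x) hf
  · exact fun f hf => (hx _ (subset_adjoin (M.inv hf))).elim
  · exact fun f hf => (hx _ ((adjoin M d).mul mem_adjoin (subset_adjoin (M.inv hf)))).elim

theorem mem_subgroup_of_mem_adjoin (hM : M.IsWide) {S : Subgroup (a ⟶ a)}
    (loop_mem : ∀ m ∈ M.arrows a a, m ∈ S)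
    (conj_mem : ∀ m ∈ M.arrows b b, d ≫ m ≫ Groupoid.inv d ∈ S)
    (hom_comp_mem : ∀ m ∈ M.arrows b a, d ≫ m ∈ S)
    {f : a ⟶ a} (hf : f ∈ (adjoin M d).arrows a a) : f ∈ S := by
  -- Every arrow out of `a` is a product of loops in `S` and an arrow of `M` or of `dM`.
  let T (y : C) (f : a ⟶ y) : Prop :=
    ∃ s ∈ S, (∃ m ∈ M.arrows a y, f = s ≫ m) ∨ ∃ m ∈ M.arrows b y, f = s ≫ d ≫ m
  have hT : T a (𝟙 a ≫ f) := by
    refine adjoin_induction_right (T := T) ?_ ?_ ?_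
      ⟨1, one_mem S, .inl ⟨𝟙 a, hM.wide a, (Category.comp_id _).symm⟩⟩ hf
    · rintro y z _ ⟨s, hs, ⟨m, hm, rfl⟩ | ⟨m, hm, rfl⟩⟩ g hg
      · exact ⟨s, hs, .inl ⟨m ≫ g, M.mul hm hg, by simp⟩⟩
      · exact ⟨s, hs, .inr ⟨m ≫ g, M.mul hm hg, by simp⟩⟩
    · rintro _ ⟨s, hs, ⟨m, hm, rfl⟩ | ⟨m, hm, rfl⟩⟩
      · exact ⟨s ≫ m, S.mul_mem hs (loop_mem m hm), .inr ⟨𝟙 b, hM.wide b, by simp⟩⟩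
      · exact ⟨s ≫ d ≫ m, S.mul_mem hs (hom_comp_mem m hm), .inr ⟨𝟙 b, hM.wide b, by simp⟩⟩
    · rintro _ ⟨s, hs, ⟨m, hm, rfl⟩ | ⟨m, hm, rfl⟩⟩
      · have hmd := S.inv_mem (hom_comp_mem _ (M.inv hm))
        refine ⟨s ≫ m ≫ Groupoid.inv d, S.mul_mem hs ?_, .inl ⟨𝟙 a, hM.wide a, by simp⟩⟩
        simpa [Groupoid.vertexGroup.inv_eq_inv] using hmd
      · exact ⟨s ≫ d ≫ m ≫ Groupoid.inv d, S.mul_mem hs (conj_mem m hm),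
          .inl ⟨𝟙 a, hM.wide a, by simp⟩⟩
  rw [Category.id_comp] at hT
  obtain ⟨s, hs, ⟨m, hm, rfl⟩ | ⟨m, hm, rfl⟩⟩ := hT
  · exact S.mul_mem hs (loop_mem m hm)
  · exact S.mul_mem hs (hom_comp_mem m hm)

end Adjoin

theorem eq_of_map_eq_mul_of_not_hasUnipotentPair {F A : Type*} [Group F] [IsFreeGroup F] [Group A]
    {φ : F →* F} (hφ : ¬ HasUnipotentPair φ) {x e : F} (he : φ e = e) (hx : φ x = x * e)
    (χ : F →* A) (hχe : χ e = 1) (hχx : ¬ IsOfFinOrder (χ x)) : φ x = x := by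
  by_cases he1 : e = 1
  · rw [hx, he1, mul_one]
  have hcomm : Commute e x := by
    by_contra h
    exact hφ ⟨e, x, 1, h, he, by rw [hx, zpow_one]⟩
  obtain ⟨i, j, hj, hij⟩ := exists_zpow_eq_zpow_of_commute hcomm.symm he1
  have hχ : χ x ^ j = 1 := by rw [← map_zpow, hij, map_zpow, hχe, one_zpow]
  exact (hχx (isOfFinOrder_iff_zpow_eq_one.2 ⟨j, hj, hχ⟩)).elim

/-- A functor from a groupoid to itself that is the identity on objects. Requiring this of the types
of the maps, rather than as an equation between objects, lets it act on each vertex group. -/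
structure VertexFixingFunctor (C : Type u) [Groupoid.{v} C] where
  map : ∀ {x y : C}, (x ⟶ y) → (x ⟶ y)
  map_id : ∀ x : C, map (𝟙 x) = 𝟙 x
  map_comp : ∀ {x y z : C} (f : x ⟶ y) (g : y ⟶ z), map (f ≫ g) = map f ≫ map g

namespace VertexFixingFunctor

variable {C : Type u} [Groupoid.{v} C] (E : VertexFixingFunctor C) {M : Subgroupoid C}
  {a b x y : C} {d : a ⟶ b} {P : b ⟶ b}

theorem map_inv (f : x ⟶ y) : E.map (inv f) = inv (E.map f) := by
  rw [← cancel_epi (E.map f), ← E.map_comp, IsIso.hom_inv_id, IsIso.hom_inv_id, E.map_id]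

/-- The endomorphism of the vertex group at `x` induced by `E`. -/
def vertexHom (x : C) : (x ⟶ x) →* (x ⟶ x) :=
  MonoidHom.mk' E.map E.map_comp

/-- The subgroupoid of morphisms that `E` maps into `K`. -/
def comap (K : Subgroupoid C) : Subgroupoid C where
  arrows x y := {f | E.map f ∈ K.arrows x y}
  inv hf := by
    rw [Groupoid.inv_eq_inv, Set.mem_ofPred_eq, E.map_inv, ← Groupoid.inv_eq_inv]
    exact K.inv hf
  mul hf _ hg := by
    rw [Set.mem_ofPred_eq, E.map_comp]
    exact K.mul hf hg

variable {E}

theorem map_mem_adjoin (hEM : M ≤ E.comap M) (hP : P ∈ M.arrows b b) (hd : E.map d = d ≫ P)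
    {f : x ⟶ y} (hf : f ∈ (adjoin M d).arrows x y) : E.map f ∈ (adjoin M d).arrows x y := by
  have hM : M ≤ E.comap (adjoin M d) :=
    (Subgroupoid.le_iff _ _).2 fun hm => subset_adjoin ((Subgroupoid.le_iff _ _).1 hEM hm)
  have hdE : E.map d ∈ (adjoin M d).arrows a b := by
    rw [hd]
    exact (adjoin M d).mul mem_adjoin (subset_adjoin hP)
  exact adjoin_subset hM hdE hf

theorem map_conj_eq_self (hd : E.map d = d ≫ P) {m : b ⟶ b} (hm : E.map m = m)
    (hPm : Commute P m) : E.map (d ≫ m ≫ inv d) = d ≫ m ≫ inv d := by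
  have hPm' : P ≫ m = m ≫ P := hPm
  simp [E.map_comp, E.map_inv, hd, hm, reassoc_of% hPm']

theorem map_eq_self_of_conj {g : a ⟶ x} {f : x ⟶ x}
    (hf : E.map (g ≫ f ≫ inv g) = g ≫ f ≫ inv g)
    (hg : Commute (E.map g ≫ inv g : a ⟶ a) (g ≫ f ≫ inv g)) : E.map f = f := by
  have hg' : (E.map g ≫ inv g) ≫ g ≫ f ≫ inv g = E.map (g ≫ f ≫ inv g) ≫ E.map g ≫ inv g :=
    hg.trans (congrArg (· ≫ E.map g ≫ inv g) hf.symm)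
  simp only [E.map_comp, E.map_inv, Category.assoc, IsIso.inv_hom_id_assoc, cancel_epi] at hg'
  exact ((cancel_mono _).1 hg').symm

theorem hasUnipotentPair_conj_vertexHom (g : a ⟶ x) (hx : HasUnipotentPair (E.vertexHom x)) :
    HasUnipotentPair
      ((MulAut.conj (g ≫ inv (E.map g) : a ⟶ a)).toMonoidHom.comp (E.vertexHom a)) := by
  refine hx.of_semiconj (Groupoid.vertexGroupIsomOfMap g).symm fun z => ?_
  change (g ≫ inv (E.map g)) * E.map (g ≫ z ≫ Groupoid.inv g) * (g ≫ inv (E.map g))⁻¹ =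
    g ≫ E.map z ≫ Groupoid.inv g
  simp [Groupoid.vertexGroup_mul, E.map_comp, E.map_inv]

variable [∀ c : C, IsFreeGroup (c ⟶ c)] {A : Type*} [Group A]

theorem map_hom_comp_eq_self (hno : ¬ HasUnipotentPair (E.vertexHom a))
    (hEM : M ≤ E.comap M) (hfix : ∀ f ∈ M.arrows a a, E.map f = f)
    (hP : P ∈ M.arrows b b) (hd : E.map d = d ≫ P) {χ : (a ⟶ a) →* A}
    (hχM : ∀ f ∈ M.arrows a a, χ f = 1) {m : b ⟶ a} (hm : m ∈ M.arrows b a)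
    (hχm : ¬ IsOfFinOrder (χ (d ≫ m))) : E.map (d ≫ m) = d ≫ m := by
  have he : Groupoid.inv m ≫ P ≫ E.map m ∈ M.arrows a a :=
    M.mul (M.inv hm) (M.mul hP ((Subgroupoid.le_iff _ _).1 hEM hm))
  refine eq_of_map_eq_mul_of_not_hasUnipotentPair hno (hfix _ he) ?_ χ (hχM _ he) hχm
  change E.map (d ≫ m) = (d ≫ m) ≫ Groupoid.inv m ≫ P ≫ E.map m
  simp [E.map_comp, hd]

theorem map_eq_self_of_mem_adjoin (hno : ∀ c, ¬ HasUnipotentPair (E.vertexHom c)) (hM : M.IsWide)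
    (hEM : M ≤ E.comap M) (hfix : ∀ c, ∀ f ∈ M.arrows c c, E.map f = f)
    (hP : P ∈ M.arrows b b) (hd : E.map d = d ≫ P) {χ : (a ⟶ a) →* A}
    (hχM : ∀ f ∈ M.arrows a a, χ f = 1) (hχd : ∀ m ∈ M.arrows b a, ¬ IsOfFinOrder (χ (d ≫ m)))
    {f : x ⟶ x} (hf : f ∈ (adjoin M d).arrows x x) : E.map f = f := by
  have hcomm {c : C} {f g : c ⟶ c} (hf : E.map f = f) (hg : E.map g = g) : Commute f g :=
    commute_of_not_hasUnipotentPair (hno c) hf hg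
  have hbase {f : a ⟶ a} (hf : f ∈ (adjoin M d).arrows a a) : E.map f = f :=
    mem_subgroup_of_mem_adjoin (S := (E.vertexHom a).eqLocus (MonoidHom.id _)) hM (hfix a)
      (fun m hm => by
        rw [Groupoid.inv_eq_inv]
        exact map_conj_eq_self hd (hfix b m hm) (hcomm (hfix b P hP) (hfix b m hm)))
      (fun m hm => map_hom_comp_eq_self (hno a) hEM (hfix a) hP hd hχM hm (hχd m hm)) hf
  by_cases hx : ∃ g : a ⟶ x, g ∈ (adjoin M d).arrows a x
  · -- Both `g f g⁻¹` and `E(g) g⁻¹` are loops at `a`, so they are fixed and commute.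
    obtain ⟨g, hg⟩ := hx
    have hgf : g ≫ f ≫ inv g ∈ (adjoin M d).arrows a a := by
      rw [← Groupoid.inv_eq_inv]
      exact (adjoin M d).mul hg ((adjoin M d).mul hf ((adjoin M d).inv hg))
    have hEg : E.map g ≫ inv g ∈ (adjoin M d).arrows a a := by
      rw [← Groupoid.inv_eq_inv]
      exact (adjoin M d).mul (map_mem_adjoin hEM hP hd hg) ((adjoin M d).inv hg)
    exact map_eq_self_of_conj (hbase hgf) (hcomm (hbase hEg) (hbase hgf))
  · exact hfix x f (mem_of_mem_adjoin hM (not_exists.1 hx) hf)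

end VertexFixingFunctor

section Graph

variable {V : Type u} [Quiver.{v} V] {H H' : Subgraph V} {a b c : V}

theorem EdgePath.InSubgraph.comp {p : EdgePath a b} {q : EdgePath b c} (hp : p.InSubgraph H)
    (hq : q.InSubgraph H) : EdgePath.InSubgraph H (Quiver.Path.comp p q : EdgePath a c) := by
  induction q with
  | nil => exact hp
  | cons q d ih => exact ⟨ih hq.1, hq.2⟩

theorem Dart.edge_swap (d : Dart a b) : Dart.edge (Sum.swap d : Dart b a) = d.edge := by
  cases d <;> rfl

theorem EdgePath.InSubgraph.reverse {p : EdgePath a b} (hp : p.InSubgraph H) :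
    EdgePath.InSubgraph H (Quiver.Path.reverse p : EdgePath b a) := by
  induction p with
  | nil => trivial
  | cons p d ih =>
    have hd : EdgePath.InSubgraph H (Dart.toEdgePath (Sum.swap d)) :=
      ⟨trivial, by rw [Dart.edge_swap]; exact hp.2⟩
    exact hd.comp (ih hp.1)

/-- The subgroupoid of the fundamental groupoid of `V` consisting of the homotopy classes of paths
in the subgraph `H`. It contains the trivial paths at all vertices, also at those outside `H`. -/
def Subgraph.subgroupoid (H : Subgraph V) : Subgroupoid (Quiver.FreeGroupoid V) where
  arrows x y := {f | ∃ p : EdgePath (V := V) x.as y.as, p.InSubgraph H ∧ p.homotopyClass = f}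
  inv := by
    rintro x y _ ⟨p, hp, rfl⟩
    exact ⟨Quiver.Path.reverse p, hp.reverse, rfl⟩
  mul := by
    rintro x y z _ ⟨p, hp, rfl⟩ _ ⟨q, hq, rfl⟩
    exact ⟨Quiver.Path.comp p q, hp.comp hq, rfl⟩

theorem Subgraph.subgroupoid_isWide (H : Subgraph V) : H.subgroupoid.IsWide :=
  ⟨fun _ => ⟨Quiver.Path.nil, trivial, rfl⟩⟩

theorem Subgraph.of_map_mem_subgroupoid {e : Edge V} (he : e ∈ H.edges) :
    (FreeGroupoid.of V).map e.hom ∈ H.subgroupoid.arrows _ _ :=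
  ⟨Dart.toEdgePath (Sum.inl e.hom), ⟨trivial, he⟩, rfl⟩

theorem Subgraph.subgroupoid_le {K : Subgroupoid (Quiver.FreeGroupoid V)} (hK : K.IsWide)
    (h : ∀ e ∈ H.edges, (FreeGroupoid.of V).map e.hom ∈ K.arrows _ _) : H.subgroupoid ≤ K := by
  rw [Subgroupoid.le_iff]
  rintro ⟨x⟩ ⟨y⟩ _ ⟨p, hp, rfl⟩
  change EdgePath (V := V) x y at p
  induction p with
  | nil => exact hK.wide _
  | cons p d ih =>
    have hd : (Dart.toEdgePath d).homotopyClass ∈ K.arrows _ _ := by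
      obtain e | e := d
      · exact h _ hp.2
      · exact K.inv (h _ hp.2)
    exact K.mul (ih hp.1) hd

theorem Subgraph.mem_subgroupoid_of_edges_eq_univ (hH : H.edges = Set.univ)
    {x y : Quiver.FreeGroupoid V} (f : x ⟶ y) : f ∈ H.subgroupoid.arrows x y := by
  have hpath {a b : V} (p : EdgePath a b) : p.InSubgraph H := by
    induction p with
    | nil => trivial
    | cons p d ih => exact ⟨ih, hH ▸ trivial⟩
  obtain ⟨p, hp⟩ := Quot.exists_rep f
  exact ⟨p, hpath p, hp⟩

theorem Subgraph.subgroupoid_le_adjoin {d : Dart a b} (hd : H.edges \ H'.edges = {d.edge}) :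
    H.subgroupoid ≤ adjoin H'.subgroupoid d.toEdgePath.homotopyClass := by
  refine subgroupoid_le ⟨fun x => subset_adjoin (H'.subgroupoid_isWide.wide x)⟩ fun e he => ?_
  by_cases he' : e ∈ H'.edges
  · exact subset_adjoin (of_map_mem_subgroupoid he')
  · obtain rfl : e = d.edge := hd.subset ⟨he, he'⟩
    obtain e | e := d
    · exact mem_adjoin
    · exact (adjoin _ _).inv mem_adjoin

section Lift

variable {D : Type w} [Groupoid D] (φ : V ⥤q D) (f : a ⟶ b)

theorem lift_map_of_map :
    (FreeGroupoid.lift φ).map ((FreeGroupoid.of V).map f) = φ.map f :=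
  Category.id_comp (φ.map f)

theorem lift_map_inv_of_map :
    (FreeGroupoid.lift φ).map (Groupoid.inv ((FreeGroupoid.of V).map f)) =
      Groupoid.inv (φ.map f) :=
  Category.id_comp (Groupoid.inv (φ.map f))

end Lift

open Classical in
/-- The functor on the fundamental groupoid counting the crossings of the edge `e` with sign. -/
noncomputable def crossingFunctor (e : Edge V) :
    Quiver.FreeGroupoid V ⥤ CategoryTheory.SingleObj (Multiplicative ℤ) :=
  FreeGroupoid.lift
    { obj := fun _ => CategoryTheory.SingleObj.star _
      map := fun {a b} f => if (⟨a, b, f⟩ : Edge V) = e then Multiplicative.ofAdd (1 : ℤ) else 1 }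

theorem crossingFunctor_map_of_mem_subgroupoid {e : Edge V} (he : e ∉ H.edges)
    {x y : Quiver.FreeGroupoid V} {f : x ⟶ y} (hf : f ∈ H.subgroupoid.arrows x y) :
    (crossingFunctor e).map f = (1 : Multiplicative ℤ) := by
  have hker : H.subgroupoid ≤ Subgroupoid.ker (crossingFunctor e) := by
    refine H.subgroupoid_le (Subgroupoid.ker_isNormal _).toIsWide fun e' he' => ?_
    refine (Subgroupoid.mem_ker_iff _ _).2 ⟨rfl, (lift_map_of_map _ _).trans ?_⟩
    exact if_neg (ne_of_mem_of_not_mem he' he)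
  obtain ⟨_, h⟩ := (Subgroupoid.mem_ker_iff _ _).1 ((Subgroupoid.le_iff _ _).1 hker hf)
  exact h

theorem crossingFunctor_map_dart_ne_one (d : Dart a b) :
    (crossingFunctor d.edge).map d.toEdgePath.homotopyClass ≠ (1 : Multiplicative ℤ) := by
  obtain e | e := d
  · exact ne_of_eq_of_ne ((lift_map_of_map _ e).trans (if_pos rfl))
      (by decide : Multiplicative.ofAdd (1 : ℤ) ≠ 1)
  · exact ne_of_eq_of_ne ((lift_map_inv_of_map _ e).trans
      (congrArg (fun i : Multiplicative ℤ => i⁻¹) (if_pos rfl)))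
      (by decide : (Multiplicative.ofAdd (1 : ℤ))⁻¹ ≠ 1)

/-- The homomorphism from a vertex group counting the crossings of the edge `e` with sign. -/
noncomputable def crossingHom (e : Edge V) (x : Quiver.FreeGroupoid V) :
    (x ⟶ x) →* Multiplicative ℤ :=
  MonoidHom.mk' (fun f => (crossingFunctor e).map f) fun f g =>
    ((crossingFunctor e).map_comp f g).trans (mul_comm (G := Multiplicative ℤ) _ _)

theorem not_isOfFinOrder_crossingHom_dart_comp {d : Dart a b} (hd : d.edge ∉ H.edges)
    {m : (FreeGroupoid.of V).obj b ⟶ (FreeGroupoid.of V).obj a}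
    (hm : m ∈ H.subgroupoid.arrows _ _) :
    ¬ IsOfFinOrder (crossingHom d.edge _ (d.toEdgePath.homotopyClass ≫ m)) := by
  have hdm : crossingHom d.edge _ (d.toEdgePath.homotopyClass ≫ m) =
      (crossingFunctor d.edge).map d.toEdgePath.homotopyClass := by
    refine ((crossingFunctor d.edge).map_comp _ _).trans ?_
    rw [crossingFunctor_map_of_mem_subgroupoid hd hm]
    exact Category.comp_id _
  rw [hdm, isOfFinOrder_iff_eq_one]
  exact crossingFunctor_map_dart_ne_one d

end Graph

section FixedVertices

variable {V : Type u} [Quiver.{v} V] (map : ∀ {a b : V}, (a ⟶ b) → EdgePath a b)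

/-- The effect on homotopy classes of a graph map fixing all vertices. -/
def vertexFixingFunctor : VertexFixingFunctor (Quiver.FreeGroupoid V) where
  map f := (GraphMap.functor ⟨id, map⟩).map f
  map_id := (GraphMap.functor ⟨id, map⟩).map_id
  map_comp := (GraphMap.functor ⟨id, map⟩).map_comp

theorem vertexFixingFunctor_map_dart {a b : V} (d : Dart a b) :
    (vertexFixingFunctor map).map d.toEdgePath.homotopyClass =
      EdgePath.homotopyClass (GraphMap.mapDart ⟨id, map⟩ d) := by
  obtain e | e := d
  · exact lift_map_of_map _ e
  · exact lift_map_inv_of_map _ e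

variable {map}

theorem subgroupoid_le_comap_of_preserves {H : Subgraph V}
    (hH : GraphMap.Preserves ⟨id, map⟩ H) :
    H.subgroupoid ≤ (vertexFixingFunctor map).comap H.subgroupoid := by
  refine H.subgroupoid_le ⟨fun x => ?_⟩ fun e he => ?_
  · exact Set.mem_of_eq_of_mem ((vertexFixingFunctor map).map_id x) (H.subgroupoid_isWide.wide x)
  · exact ⟨map e.hom, hH.2 e he, Eq.symm (lift_map_of_map _ e.hom)⟩

theorem IsPolynomialIRTT.map_eq_self_of_succ {k : ℕ} {Fil : Fin (k + 1) → Subgraph V}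
    (hΨ : IsPolynomialIRTT ⟨id, map⟩ k Fil) [∀ c : Quiver.FreeGroupoid V, IsFreeGroup (c ⟶ c)]
    (hno : ∀ c, ¬ HasUnipotentPair ((vertexFixingFunctor map).vertexHom c)) (r : Fin k)
    (hfix : ∀ c, ∀ f ∈ (Fil r.castSucc).subgroupoid.arrows c c,
      (vertexFixingFunctor map).map f = f) (c : Quiver.FreeGroupoid V) :
    ∀ f ∈ (Fil r.succ).subgroupoid.arrows c c, (vertexFixingFunctor map).map f = f := by
  obtain ⟨a, b, d, hd, -, ha, hb, P, hP, hdP⟩ := hΨ.single_edge r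
  intro f hf
  have hdE : (vertexFixingFunctor map).map d.toEdgePath.homotopyClass =
      d.toEdgePath.homotopyClass ≫ P.homotopyClass := by
    rw [vertexFixingFunctor_map_dart, hdP]
    rfl
  have hd' : d.edge ∉ (Fil r.castSucc).edges := (hd.superset rfl).2
  exact VertexFixingFunctor.map_eq_self_of_mem_adjoin hno (Subgraph.subgroupoid_isWide _)
    (subgroupoid_le_comap_of_preserves (hΨ.invariant _)) hfix ⟨P, hP, rfl⟩ hdE
    (χ := crossingHom d.edge _) (fun m hm => crossingFunctor_map_of_mem_subgroupoid hd' hm)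
    (fun m hm => not_isOfFinOrder_crossingHom_dart_comp hd' hm)
    ((Subgroupoid.le_iff _ _).1 (Subgraph.subgroupoid_le_adjoin hd) hf)

theorem IsPolynomialIRTT.map_eq_self {k : ℕ} {Fil : Fin (k + 1) → Subgraph V}
    (hΨ : IsPolynomialIRTT ⟨id, map⟩ k Fil) [∀ c : Quiver.FreeGroupoid V, IsFreeGroup (c ⟶ c)]
    (hno : ∀ c, ¬ HasUnipotentPair ((vertexFixingFunctor map).vertexHom c))
    {c : Quiver.FreeGroupoid V} (f : c ⟶ c) : (vertexFixingFunctor map).map f = f := by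
  have hfix (r : Fin (k + 1)) : ∀ c, ∀ f ∈ (Fil r).subgroupoid.arrows c c,
      (vertexFixingFunctor map).map f = f := by
    induction r using Fin.induction with
    | zero =>
      rintro ⟨c⟩ _ ⟨p, hp, rfl⟩
      change EdgePath (V := V) c c at p
      cases p with
      | nil => exact (vertexFixingFunctor map).map_id _
      | cons p d => exact absurd hp.2 (by simp [hΨ.bot_edges])
    | succ r ih => exact hΨ.map_eq_self_of_succ hno r ih
  exact hfix (Fin.last k) c f (Subgraph.mem_subgroupoid_of_edges_eq_univ hΨ.top_edges f)

end FixedVertices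

theorem IsPolynomialIRTT.obj_eq_id {V : Type u} [Quiver.{v} V] {Ψ : GraphMap V} {k : ℕ}
    {Fil : Fin (k + 1) → Subgraph V} (hΨ : IsPolynomialIRTT Ψ k Fil) : Ψ.obj = id := by
  have hfix (r : Fin (k + 1)) : ∀ x ∈ (Fil r).verts, Ψ.obj x = x := by
    induction r using Fin.induction with
    | zero => simp [hΨ.bot_verts]
    | succ r ih =>
      intro x hx
      by_cases hx' : x ∈ (Fil r.castSucc).verts
      · exact ih x hx'
      · obtain ⟨a, b, d, -, hv, ha, hb, -⟩ := hΨ.single_edge r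
        obtain rfl | rfl := hv ⟨hx, hx'⟩
        exacts [ha, hb]
  exact funext fun x => hfix (Fin.last k) x (by simp [hΨ.top_verts])

theorem exists_hasUnipotentPair_vertexHom {V : Type u} [Quiver.{v} V]
    {map : ∀ {a b : V}, (a ⟶ b) → EdgePath a b} {k : ℕ} {Fil : Fin (k + 1) → Subgraph V}
    (hΨ : IsPolynomialIRTT ⟨id, map⟩ k Fil) [∀ c : Quiver.FreeGroupoid V, IsFreeGroup (c ⟶ c)]
    {p : V} (hp : ¬ IsCyclic (FundGroup V p)) :
    ∃ c, HasUnipotentPair ((vertexFixingFunctor map).vertexHom c) := by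
  by_contra! hno
  refine hp (isCyclic_of_forall_commute fun x y => ?_)
  exact commute_of_not_hasUnipotentPair (hno _) (hΨ.map_eq_self hno x) (hΨ.map_eq_self hno y)

theorem exists_conj_hasUnipotentPair {V : Type u} [Quiver.{v} V] (hV : IsConnectedGraph V)
    {Ψ : GraphMap V} {k : ℕ} {Fil : Fin (k + 1) → Subgraph V} (hΨ : IsPolynomialIRTT Ψ k Fil)
    {F : Type w} [Group F] [IsFreeGroup F] (hF : ¬ IsCyclic F) {p : V} {ι : F ≃* FundGroup V p}
    {φ : F →* F} (hφ : IsInducedBy φ Ψ p ι) :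
    ∃ c : F, HasUnipotentPair ((MulAut.conj c).toMonoidHom.comp φ) := by
  obtain ⟨obj, map⟩ := Ψ
  obtain rfl : obj = id := hΨ.obj_eq_id
  obtain ⟨γ, hγ⟩ := hφ
  have hpath (c : Quiver.FreeGroupoid V) : Nonempty ((FreeGroupoid.of V).obj p ⟶ c) :=
    (hV p c.as).map EdgePath.homotopyClass
  have hfree (c : Quiver.FreeGroupoid V) : IsFreeGroup (c ⟶ c) :=
    IsFreeGroup.ofMulEquiv (ι.trans (Groupoid.vertexGroupIsomOfMap (hpath c).some))
  have hcyc : ¬ IsCyclic (FundGroup V p) := fun h => hF (ι.isCyclic.2 h)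
  obtain ⟨c, hc⟩ := exists_hasUnipotentPair_vertexHom hΨ hcyc
  obtain ⟨W⟩ := hpath c
  let E := vertexFixingFunctor map
  let g : FundGroup V p := γ.homotopyClass
  let s : FundGroup V p := W ≫ inv (E.map W)
  have hs := VertexFixingFunctor.hasUnipotentPair_conj_vertexHom W hc
  refine ⟨ι.symm (s * g⁻¹), hs.of_semiconj ι.symm fun z => ι.injective ?_⟩
  have hφ : ι (φ (ι.symm z)) = g * E.map z * g⁻¹ := by
    rw [hγ, ι.apply_symm_apply]
    exact (Category.assoc _ _ _).symm
  change ι (ι.symm (s * g⁻¹) * φ (ι.symm z) * (ι.symm (s * g⁻¹))⁻¹) =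
    ι (ι.symm (s * E.map z * s⁻¹))
  simp only [map_mul, map_inv, ι.apply_symm_apply, hφ]
  group

end TrainTrack

theorem mainTheorem3 {V : Type u} [Quiver.{v} V] (hV : TrainTrack.IsConnectedGraph V)
    (Ψ : TrainTrack.GraphMap V) (k : ℕ) (Fil : Fin (k + 1) → TrainTrack.Subgraph V)
    (hΨ : TrainTrack.IsPolynomialIRTT Ψ k Fil)
    {F : Type w} [Group F] [IsFreeGroup F] [Group.FG F] (hF : ¬ IsCyclic F)
    (p : V) (ι : F ≃* TrainTrack.FundGroup V p)
    (φ : F →* F) (hφ : Function.Injective φ) (hind : TrainTrack.IsInducedBy φ Ψ p ι) :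
    ¬ HasFGIP (AscendingHNN φ hφ) ∧
      ∀ θ : MulAut F, (∀ x, θ x = φ x) →
        ¬ HasFGIP (F ⋊[zpowersHom (MulAut F) θ] Multiplicative ℤ) := by
  obtain ⟨c, hc⟩ := TrainTrack.exists_conj_hasUnipotentPair hV hΨ hF hind
  refine ⟨not_hasFGIP_ascendingHNN hc hφ, fun θ hθ => ?_⟩
  have hθφ : θ.toMonoidHom = φ := MonoidHom.ext hθ
  exact not_hasFGIP_semidirectProduct (c := c) (by rwa [hθφ])
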